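/- Let $\mathbb K$ be a field, $\Gamma$ a divisible totally ordered abelian group, $\Gamma_\infty=\Gamma\cup\{\infty\}$, and $\nu_0:\mathbb K\to\Gamma_\infty$ a valuation. A valuation on a commutative ring is a map $\nu$ to $\Gamma_\infty$ with $\nu(ab)=\nu(a)+\nu(b)$, $\nu(a+b)\ge\min\{\nu(a),\nu(b)\}$, $\nu(1)=0$, $\nu(0)=\infty$ (nonzero elements may have value $\infty$). Let $$\mathcal V=\{\nu_0\}\cup\{\nu:\mathbb K[x]\to\Gamma_\infty\mid\nu\text{ is a valuation with }\nu|_{\mathbb K}=\nu_0\},$$ partially ordered by $\nu_0\le\nu$ for all $\nu\in\mathcal V$, and, for $\nu,\mu\neq\nu_0$, $\nu\le\mu$ if and only if $\nu(f)\le\mu(f)$ for all $f\in\mathbb K[x]$. Let $\mathfrak v=\{\nu_i\}_{i\in I}\subset\mathcal V$ be a nonempty totally ordered subset without maximal element, and order $I$ accordingly. A polynomial $f\in\mathbb K[x]$ is $\mathfrak v$-stable if there is $i_f\in I$ with $\nu_{i_f}\neq\nu_0$ such that $\nu_i(f)=\nu_{i_f}(f)$ for all $i\ge i_f$; then put $\mathfrak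 v(f)=\nu_{i_f}(f)$. Assume that some polynomial is not $\mathfrak v$-stable, let $Q$ be a monic polynomial of smallest degree that is not $\mathfrak v$-stable, and let $\gamma\in\Gamma_\infty$ satisfy $\gamma>\nu_i(Q)$ for all $i\in I$ with $\nu_i\ne\nu_0$. For a non-constant $q\in\mathbb K[x]$, the $q$-expansion of $f\in\mathbb K[x]$ is the unique expression $f=f_0+f_1q+\cdots+f_sq^s$ with $\deg f_j<\deg q$ for all $j$; for a valuation $\nu$ on $\mathbb K[x]$ the truncation of $\nu$ at $q$ is $\nu_q(f)=\min_{0\le j\le s}\nu(f_jq^j)$. For a valuation $\nu$ on $\mathbb K[x]$ with values in $\Gamma_\infty$, let $\overline\nu$ be an extension of $\nu$ to $\overline{\mathbb K}[x]$ with values in $\Gamma_\infty$, where $\overline{\mathbb K}$ is an algebraic closure of $\mathbb K$. For $f\in\mathbb K[x]$ put $\delta(f)=\max\{\overline\nu(x-a)\mid a\in\overline{\mathbb K},\ f(a)=0\}$ if $f$ is non-constant and $\delta(f)=-\infty$ if $f$ is a nonzero constant. A monic polynomial $P\in\mathbb K[x]$ is a key polynomial for $\nu$ if, for every choice of $\overline\nu$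 and every nonzero $f\in\mathbb K[x]$, $\delta(f)\ge\delta(P)$ implies $\deg f\ge\deg P$. Then the following hold. 1. The map $\mu:\mathbb K[x]\to\Gamma_\infty$ given by $$\mu(f)=\min_{0\le j\le r}\{\mathfrak v(f_j)+j\gamma\},$$ where $f=f_0+f_1Q+\cdots+f_rQ^r$ is the $Q$-expansion of $f$, is a valuation with $\mu|_{\mathbb K}=\nu_0$. 2. $\nu_i<\mu$ in $\mathcal V$ for every $i\in I$. 3. $\mu=\mu_Q$, and $Q$ is a key polynomial for $\mu$. -/

import Mathlib

open Polynomial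

noncomputable section

namespace KeyPoly

variable {K : Type*} [Field K]
variable {Γ : Type*} [AddCommGroup Γ] [LinearOrder Γ] [IsOrderedAddMonoid Γ]

/-! ### `q`-expansions -/

/-- The `j`-th coefficient of the `q`-expansion `f = f₀ + f₁ q + ⋯ + f_s q ^ s`, `deg f_j < deg q`,
of `f`, for a non-constant polynomial `q`, computed by repeated division by `q`. That this is the
expansion, and that the expansion is unique, is said by `degree_expansionCoeff_lt`,
`sum_expansionCoeff` and `expansionCoeff_of_eq_sum`. -/
def expansionCoeff (q : K[X]) : K[X] → ℕ → K[X]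
  | f, 0 => f % q
  | f, j + 1 => expansionCoeff q (f / q) j

theorem degree_expansionCoeff_lt {q : K[X]} (hq : 0 < q.natDegree) (f : K[X]) (j : ℕ) :
    (expansionCoeff q f j).degree < q.degree := by
  have h0 : q ≠ 0 := by rintro rfl; simp at hq
  induction j generalizing f with
  | zero => exact EuclideanDomain.mod_lt _ h0
  | succ j ih => exact ih _

theorem sum_expansionCoeff {q : K[X]} (hq : 0 < q.natDegree) (f : K[X]) {n : ℕ}
    (hn : f.natDegree < n) : f = ∑ j ∈ Finset.range n, expansionCoeff q f j * q ^ j := by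
  induction n generalizing f with
  | zero => omega
  | succ n ih =>
    rw [Finset.sum_range_succ']
    simp only [expansionCoeff, pow_zero, mul_one]
    have key : f / q = ∑ j ∈ Finset.range n, expansionCoeff q (f / q) j * q ^ j := by
      rcases Nat.eq_zero_or_pos n with rfl | hpos
      · rw [Finset.range_zero, Finset.sum_empty, Polynomial.div_eq_zero_iff
          (by rintro rfl; simp at hq)]
        exact Polynomial.degree_lt_degree (by omega)
      · refine ih _ ?_
        rcases eq_or_ne f 0 with rfl | hf
        · simpa using hpos
        · rcases eq_or_ne (f / q) 0 with hd | hd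
          · simpa [hd] using hpos
          · have := Polynomial.natDegree_lt_natDegree hd
              (Polynomial.degree_div_lt hf (Polynomial.natDegree_pos_iff_degree_pos.1 hq))
            omega
    calc f = f / q * q + f % q := by rw [mul_comm]; exact (EuclideanDomain.div_add_mod f q).symm
      _ = _ := by
        conv_lhs => rw [key]
        rw [Finset.sum_mul]
        simp only [pow_succ, mul_assoc]

theorem expansionCoeff_of_eq_sum {q : K[X]} (hq : 0 < q.natDegree) (f : K[X]) (n : ℕ)
    (c : ℕ → K[X]) (hc : ∀ j, (c j).degree < q.degree)
    (hf : f = ∑ j ∈ Finset.range n, c j * q ^ j) {j : ℕ} (hj : j < n) :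
    expansionCoeff q f j = c j := by
  have h0 : q ≠ 0 := by rintro rfl; simp at hq
  induction n generalizing f c j with
  | zero => omega
  | succ n ih =>
    have h1 : f = c 0 + q * ∑ j ∈ Finset.range n, c (j + 1) * q ^ j := by
      rw [hf, Finset.sum_range_succ', Finset.mul_sum, add_comm]
      simp only [pow_succ, pow_zero, mul_one]
      congr 1
      exact Finset.sum_congr rfl fun _ _ => by ring
    have hmod : f % q = c 0 := by
      rw [Polynomial.mod_eq_of_dvd_sub (p₂ := c 0) (by rw [h1]; simp)]
      exact (Polynomial.mod_eq_self_iff h0).2 (hc 0)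
    cases j with
    | zero => exact hmod
    | succ j =>
      refine ih (f / q) (fun j => c (j + 1)) (fun j => hc _) ?_ (by omega)
      have h2 := EuclideanDomain.div_add_mod f q
      rw [hmod] at h2
      apply mul_left_cancel₀ h0
      linear_combination h2 + h1

/-! ### Truncations -/

/-- The truncation `ν_q(f) = min_j ν(f_j q ^ j)`, where the `f_j` are the coefficients of the
`q`-expansion of `f` (they vanish for `j > deg f`, and zero terms contribute `∞`). -/
def truncation (ν : AddValuation K[X] (WithTop Γ)) (q f : K[X]) : WithTop Γ :=
  (Finset.range (f.natDegree + 1)).inf fun j => ν (expansionCoeff q f j * q ^ j)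

/-! ### Key polynomials -/

/-- `δ(f) = max {w(x - a) : f(a) = 0}` for a non-zero polynomial `f` over an algebraically closed
field with a valuation `w` on polynomials; it is `-∞` if `f` is a non-zero constant. -/
def delta {L : Type*} [Field L] (w : AddValuation L[X] (WithTop Γ)) (f : L[X]) :
    WithBot (WithTop Γ) :=
  (f.roots.map fun a => ((w (X - C a) : WithTop Γ) : WithBot (WithTop Γ))).sup

/-- `w`, a valuation on `K̄[x]`, extends the valuation `ν` on `K[x]`. -/
def Extends (ν : AddValuation K[X] (WithTop Γ))
    (w : AddValuation (AlgebraicClosure K)[X] (WithTop Γ)) : Prop :=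
  ∀ f : K[X], w (f.map (algebraMap K (AlgebraicClosure K))) = ν f

/-- `Q` is a key polynomial for `ν`: it is monic and, for an extension `w` of `ν` to `K̄[x]`, every
non-zero `f ∈ K[x]` with `δ(f) ≥ δ(Q)` has `deg f ≥ deg Q`. Here `δ` is taken with respect to `w`;
its values on `K[x]` do not depend on the choice of `w`, and the condition is imposed for every
choice. When `Γ` is divisible, an extension of `ν` with values in `Γ ∪ {∞}` exists, and all
extensions with values in ordered groups containing `Γ` have values in `Γ ∪ {∞}`. -/
def IsKeyPolynomial (ν : AddValuation K[X] (WithTop Γ)) (Q : K[X]) : Prop :=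
  Q.Monic ∧
    ∀ w : AddValuation (AlgebraicClosure K)[X] (WithTop Γ), Extends ν w →
      ∀ f : K[X], f ≠ 0 →
        delta w (Q.map (algebraMap K (AlgebraicClosure K))) ≤
          delta w (f.map (algebraMap K (AlgebraicClosure K))) →
        Q.degree ≤ f.degree

/-! ### The partially ordered set of extensions of `ν₀` -/

/-- A valuation on `K[x]` with values in `Γ ∪ {∞}` that extends the valuation `ν₀` on `K`. -/
@[ext]
structure PolyVal (ν₀ : AddValuation K (WithTop Γ)) where
  /-- the underlying valuation on `K[x]` -/
  val : AddValuation K[X] (WithTop Γ)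
  /-- its restriction to `K` is `ν₀` -/
  val_C : ∀ a : K, val (C a) = ν₀ a

/-- `ν ≤ μ` if and only if `ν(f) ≤ μ(f)` for every `f`. -/
instance (ν₀ : AddValuation K (WithTop Γ)) : PartialOrder (PolyVal ν₀) :=
  PartialOrder.lift (fun ν (f : K[X]) => ν.val f) fun _ _ h =>
    PolyVal.ext (AddValuation.ext fun f => congrFun h f)

/-- `𝒱 = {ν₀} ∪ {ν : ν a valuation on K[x] extending ν₀}`: the bottom element `⊥` is `ν₀`, which lies
below all the valuations on `K[x]`. -/
abbrev ValPoset (ν₀ : AddValuation K (WithTop Γ)) : Type _ :=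
  WithBot (PolyVal ν₀)

variable {ν₀ : AddValuation K (WithTop Γ)}

/-! ### Stability and the map `μ` -/

/-- `ν` is an index from which on the values of the family `v` at `f` are constant. -/
def IsStableFrom (v : Set (ValPoset ν₀)) (f : K[X]) (ν : PolyVal ν₀) : Prop :=
  (ν : ValPoset ν₀) ∈ v ∧
    ∀ ν' : PolyVal ν₀, (ν' : ValPoset ν₀) ∈ v → ν ≤ ν' → ν'.val f = ν.val f

/-- `f` is `v`-stable. -/
def IsStable (v : Set (ValPoset ν₀)) (f : K[X]) : Prop :=
  ∃ ν : PolyVal ν₀, IsStableFrom v f ν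

open Classical in
/-- The stable value `v(f) = ν_{i_f}(f)` of a `v`-stable polynomial `f` (and `∞`, a default value,
if `f` is not `v`-stable). -/
def stableValue (v : Set (ValPoset ν₀)) (f : K[X]) : WithTop Γ :=
  if h : IsStable v f then h.choose.val f else ⊤

/-- The stable value does not depend on the index. -/
theorem stableValue_eq {v : Set (ValPoset ν₀)} (hv : IsChain (· ≤ ·) v) {f : K[X]} {ν : PolyVal ν₀}
    (h : IsStableFrom v f ν) : stableValue v f = ν.val f := by
  have hs : IsStable v f := ⟨ν, h⟩
  rw [stableValue, dif_pos hs]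
  have h' := hs.choose_spec
  rcases hv.total h.1 h'.1 with hle | hle
  · exact h.2 _ h'.1 (WithBot.coe_le_coe.1 hle)
  · exact (h'.2 _ h.1 (WithBot.coe_le_coe.1 hle)).symm

/-- The map `f₀ + f₁ Q + ⋯ + f_r Q ^ r ↦ min_j (v(f_j) + j γ)` on `Q`-expansions. -/
def limitMap (v : Set (ValPoset ν₀)) (Q : K[X]) (γ : WithTop Γ) (f : K[X]) : WithTop Γ :=
  (Finset.range (f.natDegree + 1)).inf fun j => stableValue v (expansionCoeff Q f j) + j • γ

end KeyPoly

end

open Polynomial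

noncomputable section

namespace KeyPoly

variable {K : Type*} [Field K]
variable {Γ : Type*} [AddCommGroup Γ] [LinearOrder Γ] [IsOrderedAddMonoid Γ]

/-! ### More on `q`-expansions -/

theorem expansionCoeff_add {q : K[X]} (hq : 0 < q.natDegree) (f g : K[X]) (j : ℕ) :
    expansionCoeff q (f + g) j = expansionCoeff q f j + expansionCoeff q g j := by
  have hf := sum_expansionCoeff hq f (n := f.natDegree + g.natDegree + j + 1) (by omega)
  have hg := sum_expansionCoeff hq g (n := f.natDegree + g.natDegree + j + 1) (by omega)
  refine expansionCoeff_of_eq_sum hq (f + g) (f.natDegree + g.natDegree + j + 1)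
    (fun j => expansionCoeff q f j + expansionCoeff q g j) (fun j => ?_) ?_ (by omega)
  · exact (degree_add_le _ _).trans_lt
      (max_lt (degree_expansionCoeff_lt hq f j) (degree_expansionCoeff_lt hq g j))
  · simp only [add_mul, Finset.sum_add_distrib]
    exact congrArg₂ (· + ·) hf hg

theorem expansionCoeff_zero (q : K[X]) (j : ℕ) : expansionCoeff q 0 j = 0 := by
  induction j with
  | zero => simp [expansionCoeff]
  | succ j ih => simpa [expansionCoeff] using ih

theorem expansionCoeff_neg {q : K[X]} (hq : 0 < q.natDegree) (f : K[X]) (j : ℕ) :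
    expansionCoeff q (-f) j = -expansionCoeff q f j := by
  have h := expansionCoeff_add hq f (-f) j
  rw [add_neg_cancel, expansionCoeff_zero] at h
  exact (neg_eq_of_add_eq_zero_right h.symm).symm

theorem natDegree_expansionCoeff_lt {q : K[X]} (hq : 0 < q.natDegree) (f : K[X]) (j : ℕ) :
    (expansionCoeff q f j).natDegree < q.natDegree := by
  induction j generalizing f with
  | zero => exact natDegree_mod_lt _ hq.ne'
  | succ j ih => exact ih _

theorem div_eq_zero_of_natDegree_lt {q f : K[X]} (h : f.natDegree < q.natDegree) : f / q = 0 :=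
  (Polynomial.div_eq_zero_iff (by rintro rfl; simp at h)).2 (degree_lt_degree h)

theorem mod_eq_self_of_natDegree_lt {q f : K[X]} (h : f.natDegree < q.natDegree) : f % q = f :=
  (mod_eq_self_iff (by rintro rfl; simp at h)).2 (degree_lt_degree h)

theorem natDegree_div_of_monic {q : K[X]} (hq : q.Monic) (f : K[X]) :
    (f / q).natDegree = f.natDegree - q.natDegree := by
  rw [← divByMonic_eq_div f hq, natDegree_divByMonic f hq]

theorem expansionCoeff_eq_zero {q : K[X]} (hq : q.Monic) (hd : 0 < q.natDegree) {f : K[X]} {j : ℕ}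
    (h : f.natDegree < j) : expansionCoeff q f j = 0 := by
  induction j generalizing f with
  | zero => omega
  | succ j ih =>
    rw [expansionCoeff]
    by_cases hf : f.natDegree < q.natDegree
    · rw [div_eq_zero_of_natDegree_lt hf, expansionCoeff_zero]
    · exact ih (by rw [natDegree_div_of_monic hq]; omega)

/-! ### Minima over `q`-expansions -/

/-- The map `f₀ + f₁ q + ⋯ + f_r q ^ r ↦ min_j (V(f_j) + j γ)` on `q`-expansions. -/
def expansionMin (V : K[X] → WithTop Γ) (q : K[X]) (γ : WithTop Γ) (f : K[X]) : WithTop Γ :=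
  (Finset.range (f.natDegree + 1)).inf fun j => V (expansionCoeff q f j) + j • γ

/-- The conditions on a map `V` on the polynomials of degree less than `deg q`, under which
`expansionMin V q γ` is a valuation. -/
structure IsResidual (V : K[X] → WithTop Γ) (q : K[X]) (γ : WithTop Γ) : Prop where
  monic : q.Monic
  natDegree_pos : 0 < q.natDegree
  map_zero : V 0 = ⊤
  map_one : V 1 = 0
  map_neg : ∀ f, f.natDegree < q.natDegree → V (-f) = V f
  map_add : ∀ f g, f.natDegree < q.natDegree → g.natDegree < q.natDegree →
    min (V f) (V g) ≤ V (f + g)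
  map_mul_mod : ∀ f g, f.natDegree < q.natDegree → g.natDegree < q.natDegree →
    V (f * g % q) = V f + V g
  le_map_mul_div : ∀ f g, f.natDegree < q.natDegree → g.natDegree < q.natDegree →
    V f + V g ≤ V (f * g / q) + γ

namespace IsResidual

variable {V : K[X] → WithTop Γ} {q : K[X]} {γ : WithTop Γ}

theorem le_expansionMin_iff (h : IsResidual V q γ) {f : K[X]} {m : WithTop Γ} :
    m ≤ expansionMin V q γ f ↔ ∀ j, m ≤ V (expansionCoeff q f j) + j • γ := by
  rw [expansionMin, Finset.le_inf_iff]
  refine ⟨fun H j => ?_, fun H j _ => H j⟩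
  by_cases hj : j < f.natDegree + 1
  · exact H j (Finset.mem_range.2 hj)
  · rw [expansionCoeff_eq_zero h.monic h.natDegree_pos (by omega), h.map_zero, top_add]
    exact le_top

theorem expansionMin_eq_min (h : IsResidual V q γ) (f : K[X]) :
    expansionMin V q γ f = min (V (f % q)) (expansionMin V q γ (f / q) + γ) := by
  refine eq_of_forall_le_iff fun m => ?_
  rw [h.le_expansionMin_iff, le_min_iff]
  constructor
  · refine fun H => ⟨by simpa [expansionCoeff] using H 0, ?_⟩
    obtain ⟨j, -, hj⟩ := Finset.exists_mem_eq_inf (Finset.range ((f / q).natDegree + 1)) (by simp)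
      fun j => V (expansionCoeff q (f / q) j) + j • γ
    rw [expansionMin, hj, add_assoc, ← succ_nsmul]
    exact H (j + 1)
  · rintro ⟨h0, h1⟩ (_ | j)
    · simpa [expansionCoeff] using h0
    · rw [expansionCoeff, succ_nsmul, ← add_assoc]
      exact h1.trans (add_le_add_left (h.le_expansionMin_iff.1 le_rfl j) γ)

theorem expansionMin_zero (h : IsResidual V q γ) : expansionMin V q γ 0 = ⊤ :=
  top_unique <| h.le_expansionMin_iff.2 fun j => by simp [expansionCoeff_zero, h.map_zero]

theorem expansionMin_of_natDegree_lt (h : IsResidual V q γ) {f : K[X]}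
    (hf : f.natDegree < q.natDegree) : expansionMin V q γ f = V f := by
  rw [h.expansionMin_eq_min, mod_eq_self_of_natDegree_lt hf, div_eq_zero_of_natDegree_lt hf,
    h.expansionMin_zero, top_add, min_top_right]

theorem expansionMin_mul_self (h : IsResidual V q γ) (f : K[X]) :
    expansionMin V q γ (q * f) = expansionMin V q γ f + γ := by
  rw [h.expansionMin_eq_min, mul_div_cancel_left₀ _ h.monic.ne_zero,
    EuclideanDomain.mod_eq_zero.2 (dvd_mul_right q f), h.map_zero, min_top_left]

theorem expansionMin_neg (h : IsResidual V q γ) (f : K[X]) :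
    expansionMin V q γ (-f) = expansionMin V q γ f := by
  refine eq_of_forall_le_iff fun m => ?_
  simp only [h.le_expansionMin_iff, expansionCoeff_neg h.natDegree_pos,
    h.map_neg _ (natDegree_expansionCoeff_lt h.natDegree_pos f _)]

theorem min_le_expansionMin_add (h : IsResidual V q γ) (f g : K[X]) :
    min (expansionMin V q γ f) (expansionMin V q γ g) ≤ expansionMin V q γ (f + g) := by
  refine h.le_expansionMin_iff.2 fun j => ?_
  have hd := natDegree_expansionCoeff_lt h.natDegree_pos (q := q)
  rw [expansionCoeff_add h.natDegree_pos]
  refine (min_le_min (h.le_expansionMin_iff.1 le_rfl j) (h.le_expansionMin_iff.1 le_rfl j)).trans ?_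
  rw [min_add_add_right]
  exact add_le_add_left (h.map_add _ _ (hd f j) (hd g j)) _

theorem expansionMin_add_of_lt (h : IsResidual V q γ) {f g : K[X]}
    (hfg : expansionMin V q γ g < expansionMin V q γ f) :
    expansionMin V q γ (f + g) = expansionMin V q γ g := by
  refine le_antisymm (not_lt.1 fun hlt => ?_) ?_
  · have := h.min_le_expansionMin_add (f + g) (-f)
    rw [h.expansionMin_neg, add_neg_cancel_comm] at this
    exact (lt_min hlt hfg).not_ge this
  · simpa [hfg.le] using h.min_le_expansionMin_add f g

theorem add_le_expansionMin_mul (h : IsResidual V q γ) (f g : K[X]) :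
    expansionMin V q γ f + expansionMin V q γ g ≤ expansionMin V q γ (f * g) := by
  have hq := h.natDegree_pos
  obtain ⟨n, hn⟩ : ∃ n, f.natDegree + g.natDegree = n := ⟨_, rfl⟩
  induction n using Nat.strong_induction_on generalizing f g with
  | _ n ih =>
    have main : ∀ f g : K[X], f.natDegree + g.natDegree = n → q.natDegree ≤ f.natDegree →
        expansionMin V q γ f + expansionMin V q γ g ≤ expansionMin V q γ (f * g) := by
      intro f g hn hf
      have hdiv := natDegree_div_of_monic h.monic f
      have hmod := natDegree_mod_lt f hq.ne'
      have h1 := ih _ (by omega) (f % q) g rfl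
      have h2 := ih _ (by omega) (f / q) g rfl
      rw [h.expansionMin_of_natDegree_lt hmod] at h1
      have hsplit : f * g = f % q * g + q * (f / q * g) := by
        conv_lhs => rw [← EuclideanDomain.div_add_mod f q]
        ring
      rw [hsplit, h.expansionMin_eq_min f, ← min_add_add_right]
      refine le_trans (min_le_min h1 ?_) (h.min_le_expansionMin_add _ _)
      rw [h.expansionMin_mul_self, add_right_comm]
      exact add_le_add_left h2 γ
    by_cases hf : q.natDegree ≤ f.natDegree
    · exact main f g hn hf
    by_cases hg : q.natDegree ≤ g.natDegree
    · rw [mul_comm, add_comm]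
      exact main g f (by omega) hg
    rw [not_le] at hf hg
    have hd : (f * g / q).natDegree < q.natDegree := by
      have := natDegree_mul_le (p := f) (q := g)
      rw [natDegree_div_of_monic h.monic]
      omega
    rw [h.expansionMin_eq_min (f * g), h.expansionMin_of_natDegree_lt hd,
      h.expansionMin_of_natDegree_lt hf, h.expansionMin_of_natDegree_lt hg]
    exact le_min (h.map_mul_mod f g hf hg).ge (h.le_map_mul_div f g hf hg)

theorem expansionMin_mul (h : IsResidual V q γ) (f g : K[X]) :
    expansionMin V q γ (f * g) = expansionMin V q γ f + expansionMin V q γ g := by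
  have hq := h.natDegree_pos
  obtain ⟨n, hn⟩ : ∃ n, f.natDegree + g.natDegree = n := ⟨_, rfl⟩
  induction n using Nat.strong_induction_on generalizing f g with
  | _ n ih =>
    have main : ∀ f g : K[X], f.natDegree + g.natDegree = n →
        expansionMin V q γ f < V (f % q) →
        expansionMin V q γ (f * g) = expansionMin V q γ f + expansionMin V q γ g := by
      intro f g hn hlt
      have hmod := natDegree_mod_lt f hq.ne'
      rcases eq_or_ne (expansionMin V q γ g) ⊤ with hg | hg
      · have := h.add_le_expansionMin_mul f g
        rw [hg, add_top] at this ⊢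
        exact top_unique this
      have hf : q.natDegree ≤ f.natDegree := by
        by_contra! hf
        rw [h.expansionMin_of_natDegree_lt hf, mod_eq_self_of_natDegree_lt hf] at hlt
        exact hlt.false
      have hdiv := natDegree_div_of_monic h.monic f
      have h2 : expansionMin V q γ (q * (f / q * g)) =
          expansionMin V q γ f + expansionMin V q γ g := by
        have hf' := h.expansionMin_eq_min f
        rcases min_choice (V (f % q)) (expansionMin V q γ (f / q) + γ) with hc | hc
        · exact absurd (hf'.trans hc) hlt.ne
        · rw [h.expansionMin_mul_self, ih _ (by omega) (f / q) g rfl, hf', hc, add_right_comm]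
      have hsplit : f * g = f % q * g + q * (f / q * g) := by
        conv_lhs => rw [← EuclideanDomain.div_add_mod f q]
        ring
      rw [hsplit, ← h2]
      apply h.expansionMin_add_of_lt
      rw [h2]
      refine lt_of_lt_of_le ?_ (h.add_le_expansionMin_mul _ _)
      rw [h.expansionMin_of_natDegree_lt hmod]
      exact WithTop.add_lt_add_right hg hlt
    by_cases hf : expansionMin V q γ f < V (f % q)
    · exact main f g hn hf
    by_cases hg : expansionMin V q γ g < V (g % q)
    · rw [mul_comm, add_comm]
      exact main g f (by omega) hg
    rw [not_lt] at hf hg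
    refine le_antisymm ?_ (h.add_le_expansionMin_mul f g)
    rw [h.expansionMin_eq_min (f * g), mul_mod]
    refine (min_le_left _ _).trans ?_
    rw [h.map_mul_mod _ _ (natDegree_mod_lt f hq.ne') (natDegree_mod_lt g hq.ne')]
    exact add_le_add hf hg

/-- The valuation `f₀ + f₁ q + ⋯ + f_r q ^ r ↦ min_j (V(f_j) + j γ)`. -/
def valuation (h : IsResidual V q γ) : AddValuation K[X] (WithTop Γ) :=
  AddValuation.of (expansionMin V q γ) h.expansionMin_zero
    (by rw [h.expansionMin_of_natDegree_lt (by simpa using h.natDegree_pos), h.map_one])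
    h.min_le_expansionMin_add h.expansionMin_mul

theorem valuation_apply (h : IsResidual V q γ) (f : K[X]) :
    h.valuation f = expansionMin V q γ f := rfl

theorem valuation_of_natDegree_lt (h : IsResidual V q γ) {f : K[X]}
    (hf : f.natDegree < q.natDegree) : h.valuation f = V f :=
  h.expansionMin_of_natDegree_lt hf

theorem valuation_self (h : IsResidual V q γ) : h.valuation q = γ := by
  have := h.expansionMin_mul_self 1
  rwa [mul_one, h.expansionMin_of_natDegree_lt (f := 1) (by simpa using h.natDegree_pos),
    h.map_one, zero_add] at this

theorem valuation_eq_truncation (h : IsResidual V q γ) (f : K[X]) :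
    h.valuation f = truncation h.valuation q f := by
  rw [h.valuation_apply, expansionMin, truncation]
  refine Finset.inf_congr rfl fun j _ => ?_
  rw [AddValuation.map_mul, AddValuation.map_pow, h.valuation_self,
    h.valuation_of_natDegree_lt (natDegree_expansionCoeff_lt h.natDegree_pos f j)]

end IsResidual

/-! ### Stable polynomials -/

section Stable

variable {ν₀ : AddValuation K (WithTop Γ)} {v : Set (ValPoset ν₀)} {f g Q : K[X]}

theorem IsStableFrom.of_le {ν ν' : PolyVal ν₀} (h : IsStableFrom v f ν)
    (hν' : (ν' : ValPoset ν₀) ∈ v) (hle : ν ≤ ν') : IsStableFrom v f ν' :=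
  ⟨hν', fun ν'' h'' hle' => (h.2 ν'' h'' (hle.trans hle')).trans (h.2 ν' hν' hle).symm⟩

theorem exists_ge_of_isChain (hv : IsChain (· ≤ ·) v) {ν ν' : PolyVal ν₀}
    (hν : (ν : ValPoset ν₀) ∈ v) (hν' : (ν' : ValPoset ν₀) ∈ v) :
    ∃ ν'' : PolyVal ν₀, (ν'' : ValPoset ν₀) ∈ v ∧ ν ≤ ν'' ∧ ν' ≤ ν'' := by
  rcases hv.total hν hν' with h | h
  · exact ⟨ν', hν', WithBot.coe_le_coe.1 h, le_rfl⟩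
  · exact ⟨ν, hν, le_rfl, WithBot.coe_le_coe.1 h⟩

/-- Finitely many stable polynomials are stable from a common index on. -/
theorem exists_isStableFrom_forall {ι : Type*} (hv : IsChain (· ≤ ·) v) {ν : PolyVal ν₀}
    (hν : (ν : ValPoset ν₀) ∈ v) (s : Finset ι) (c : ι → K[X]) (hc : ∀ i ∈ s, IsStable v (c i)) :
    ∃ ν' : PolyVal ν₀, (ν' : ValPoset ν₀) ∈ v ∧ ν ≤ ν' ∧ ∀ i ∈ s, IsStableFrom v (c i) ν' := by
  classical
  induction s using Finset.induction_on with
  | empty => exact ⟨ν, hν, le_rfl, by simp⟩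
  | insert i s _ ih =>
    obtain ⟨ν₁, h₁, hle₁, hs₁⟩ := ih fun j hj => hc j (Finset.mem_insert_of_mem hj)
    obtain ⟨ν₂, h₂⟩ := hc i (Finset.mem_insert_self i s)
    obtain ⟨ν₃, h₃, h₁₃, h₂₃⟩ := exists_ge_of_isChain hv h₁ h₂.1
    refine ⟨ν₃, h₃, hle₁.trans h₁₃, fun j hj => ?_⟩
    rcases Finset.mem_insert.1 hj with rfl | hj
    · exact h₂.of_le h₃ h₂₃
    · exact (hs₁ j hj).of_le h₃ h₁₃

theorem IsStableFrom.neg {ν : PolyVal ν₀} (h : IsStableFrom v f ν) : IsStableFrom v (-f) ν :=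
  ⟨h.1, fun ν' hν' hle => by simpa only [AddValuation.map_neg] using h.2 ν' hν' hle⟩

theorem IsStableFrom.mul {ν : PolyVal ν₀} (hf : IsStableFrom v f ν) (hg : IsStableFrom v g ν) :
    IsStableFrom v (f * g) ν :=
  ⟨hf.1, fun ν' hν' hle => by
    rw [AddValuation.map_mul, AddValuation.map_mul, hf.2 ν' hν' hle, hg.2 ν' hν' hle]⟩

theorem isStableFrom_C {ν : PolyVal ν₀} (hν : (ν : ValPoset ν₀) ∈ v) (a : K) :
    IsStableFrom v (C a) ν :=
  ⟨hν, fun ν' _ _ => by rw [ν'.val_C, ν.val_C]⟩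

theorem exists_lt_of_not_isStable (hQ : ¬ IsStable v Q) {ν : PolyVal ν₀}
    (hν : (ν : ValPoset ν₀) ∈ v) :
    ∃ ν' : PolyVal ν₀, (ν' : ValPoset ν₀) ∈ v ∧ ν ≤ ν' ∧ ν.val Q < ν'.val Q := by
  by_contra! H
  exact hQ ⟨ν, hν, fun ν' hν' hle => le_antisymm (H ν' hν' hle) (hle Q)⟩

/-- Dividing a stable polynomial by an unstable one, with stable quotient and remainder, does not
change the stable value of the remainder. -/
theorem IsStableFrom.val_eq_of_eq_mul_add {ν : PolyVal ν₀} (hQ : ¬ IsStable v Q) {q r : K[X]}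
    (hf : IsStableFrom v f ν) (hq : IsStableFrom v q ν) (hr : IsStableFrom v r ν)
    (h : f = Q * q + r) : ν.val r = ν.val f := by
  by_contra hne
  obtain ⟨ν', hν', hle, hlt⟩ := exists_lt_of_not_isStable hQ hf.1
  have hsub : Q * q = -r + f := by rw [h]; ring
  have h1 := congrArg ν.val hsub
  have h2 := congrArg ν'.val hsub
  have hne' : ν'.val r ≠ ν'.val f := by rwa [hf.2 ν' hν' hle, hr.2 ν' hν' hle]
  rw [AddValuation.map_mul, AddValuation.map_add_of_distinct_val _
    (by rwa [AddValuation.map_neg]), AddValuation.map_neg] at h1 h2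
  rw [hf.2 ν' hν' hle, hr.2 ν' hν' hle, hq.2 ν' hν' hle, ← h1] at h2
  have hqt : ν.val q ≠ ⊤ := by
    intro ht
    rw [ht, add_top] at h1
    have := min_eq_top.1 h1.symm
    exact hne (this.1.trans this.2.symm)
  exact (WithTop.add_lt_add_right hqt hlt).ne' h2

theorem isResidual_stableValue (hchain : IsChain (· ≤ ·) v) {ν : PolyVal ν₀}
    (hν : (ν : ValPoset ν₀) ∈ v) (hQ : Q.Monic) (hQv : ¬ IsStable v Q)
    (hmin : ∀ f : K[X], f.natDegree < Q.natDegree → IsStable v f) {γ : WithTop Γ}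
    (hγ : ∀ ν : PolyVal ν₀, (ν : ValPoset ν₀) ∈ v → ν.val Q < γ) :
    IsResidual (stableValue v) Q γ := by
  have hpos : 0 < Q.natDegree := by
    by_contra! h0
    replace h0 := hQ.natDegree_eq_zero.1 (Nat.le_zero.1 h0)
    exact hQv ⟨ν, by rw [h0, ← C_1]; exact isStableFrom_C hν 1⟩
  have hdiv : ∀ f g : K[X], f.natDegree < Q.natDegree → g.natDegree < Q.natDegree →
      ∃ ν : PolyVal ν₀, IsStableFrom v f ν ∧ IsStableFrom v g ν ∧
        IsStableFrom v (f * g / Q) ν ∧ IsStableFrom v (f * g % Q) ν := by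
    intro f g hf hg
    have hd : (f * g / Q).natDegree < Q.natDegree := by
      have := natDegree_mul_le (p := f) (q := g)
      rw [natDegree_div_of_monic hQ]
      omega
    obtain ⟨ν', -, -, h⟩ := exists_isStableFrom_forall hchain hν Finset.univ
      ![f, g, f * g / Q, f * g % Q] (by
        simp [Fin.forall_fin_succ, hmin f hf, hmin g hg, hmin _ hd,
          hmin _ (natDegree_mod_lt (f * g) hpos.ne')])
    simp [Fin.forall_fin_succ] at h
    exact ⟨ν', h⟩
  refine ⟨hQ, hpos, ?_, ?_, ?_, ?_, ?_, ?_⟩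
  · rw [← C_0, stableValue_eq hchain (isStableFrom_C hν 0), C_0, AddValuation.map_zero]
  · rw [← C_1, stableValue_eq hchain (isStableFrom_C hν 1), C_1, AddValuation.map_one]
  · intro f hf
    obtain ⟨ν', h⟩ := hmin f hf
    rw [stableValue_eq hchain h, stableValue_eq hchain h.neg, AddValuation.map_neg]
  · intro f g hf hg
    have hs : (f + g).natDegree < Q.natDegree :=
      (natDegree_add_le f g).trans_lt (max_lt hf hg)
    obtain ⟨ν', -, -, h⟩ := exists_isStableFrom_forall hchain hν Finset.univ
      ![f, g, f + g] (by
        simp [Fin.forall_fin_succ, hmin f hf, hmin g hg, hmin _ hs])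
    simp [Fin.forall_fin_succ] at h
    rw [stableValue_eq hchain h.1, stableValue_eq hchain h.2.1, stableValue_eq hchain h.2.2]
    exact AddValuation.map_add _ _ _
  · intro f g hf hg
    obtain ⟨ν', h1, h2, h3, h4⟩ := hdiv f g hf hg
    rw [stableValue_eq hchain h1, stableValue_eq hchain h2, stableValue_eq hchain h4,
      (h1.mul h2).val_eq_of_eq_mul_add hQv h3 h4 (EuclideanDomain.div_add_mod _ _).symm,
      AddValuation.map_mul]
  · intro f g hf hg
    obtain ⟨ν', h1, h2, h3, h4⟩ := hdiv f g hf hg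
    have hr := (h1.mul h2).val_eq_of_eq_mul_add hQv h3 h4 (EuclideanDomain.div_add_mod _ _).symm
    rw [stableValue_eq hchain h1, stableValue_eq hchain h2, stableValue_eq hchain h3,
      ← AddValuation.map_mul]
    have hsub : f * g / Q * Q = f * g - f * g % Q := by
      linear_combination EuclideanDomain.div_add_mod (f * g) Q
    calc ν'.val (f * g) ≤ ν'.val (f * g / Q * Q) := by
          rw [hsub]
          exact AddValuation.map_le_sub _ le_rfl hr.ge
      _ = ν'.val (f * g / Q) + ν'.val Q := AddValuation.map_mul _ _ _
      _ ≤ ν'.val (f * g / Q) + γ := add_le_add_right (hγ ν' h1.1).le _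

theorem val_le_expansionMin_stableValue (hchain : IsChain (· ≤ ·) v) (hQv : ¬ IsStable v Q)
    (hmin : ∀ f : K[X], f.natDegree < Q.natDegree → IsStable v f) {γ : WithTop Γ}
    (hγ : ∀ ν : PolyVal ν₀, (ν : ValPoset ν₀) ∈ v → ν.val Q < γ)
    (h : IsResidual (stableValue v) Q γ) {ν : PolyVal ν₀} (hν : (ν : ValPoset ν₀) ∈ v) (f : K[X]) :
    ν.val f ≤ expansionMin (stableValue v) Q γ f := by
  have hpos := h.natDegree_pos
  obtain ⟨n, hn⟩ : ∃ n, f.natDegree = n := ⟨_, rfl⟩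
  induction n using Nat.strong_induction_on generalizing f ν with
  | _ n ih =>
    obtain ⟨ν₁, h₁⟩ := hmin (f % Q) (natDegree_mod_lt f hpos.ne')
    obtain ⟨ν', hν', hle, hle₁⟩ := exists_ge_of_isChain hchain hν h₁.1
    have hs := h₁.of_le hν' hle₁
    by_cases hf : f.natDegree < Q.natDegree
    · rw [mod_eq_self_of_natDegree_lt hf] at hs
      rw [h.expansionMin_of_natDegree_lt hf, stableValue_eq hchain hs]
      exact hle f
    have hdiv : ∀ ν' : PolyVal ν₀, (ν' : ValPoset ν₀) ∈ v →
        ν'.val (Q * (f / Q)) ≤ expansionMin (stableValue v) Q γ (f / Q) + γ := fun ν' hν' => by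
      rw [AddValuation.map_mul, add_comm]
      refine add_le_add (ih _ ?_ hν' (f / Q) rfl) (hγ ν' hν').le
      rw [natDegree_div_of_monic h.monic]
      omega
    have hne : ∀ ν' : PolyVal ν₀, (ν' : ValPoset ν₀) ∈ v → ν ≤ ν' → IsStableFrom v (f % Q) ν' →
        ν'.val (Q * (f / Q)) ≠ ν'.val (f % Q) →
        ν.val f ≤ expansionMin (stableValue v) Q γ f := by
      intro ν' hν' hle hs hne
      rw [h.expansionMin_eq_min, stableValue_eq hchain hs, min_comm]
      refine (hle f).trans ?_
      conv_lhs => rw [← EuclideanDomain.div_add_mod f Q]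
      change ν'.val _ ≤ _
      rw [AddValuation.map_add_of_distinct_val _ hne]
      exact min_le_min (hdiv ν' hν') le_rfl
    by_cases heq : ν'.val (Q * (f / Q)) = ν'.val (f % Q)
    · rcases eq_or_ne (ν'.val (f % Q)) ⊤ with ht | ht
      · have := hdiv ν' hν'
        rw [heq, ht, top_le_iff] at this
        rw [h.expansionMin_eq_min, this, stableValue_eq hchain hs, ht, min_self]
        exact le_top
      · obtain ⟨ν'', hν'', hle', hlt⟩ := exists_lt_of_not_isStable hQv hν'
        refine hne ν'' hν'' (hle.trans hle') (hs.of_le hν'' hle') ?_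
        rw [hs.2 ν'' hν'' hle', ← heq, AddValuation.map_mul, AddValuation.map_mul]
        have hft : ν'.val (f / Q) ≠ ⊤ := by
          intro ht'
          rw [AddValuation.map_mul, ht', add_top] at heq
          exact ht heq.symm
        exact ((WithTop.add_lt_add_right hft hlt).trans_le
          (add_le_add_right (hle' (f / Q)) _)).ne'
    · exact hne ν' hν' hle hs heq

end Stable

/-! ### Key polynomials -/

section Delta

variable {L : Type*} [Field L] (w : AddValuation L[X] (WithTop Γ))

theorem map_prod_eq_sum {R : Type*} [CommRing R] (w : AddValuation R (WithTop Γ))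
    (s : Multiset R) : w s.prod = (s.map w).sum := by
  induction s using Multiset.induction_on with
  | empty => simp
  | cons a s ih => simp [AddValuation.map_mul, ih]

theorem val_eq_sum_roots [IsAlgClosed L] (f : L[X]) :
    w f = w (C f.leadingCoeff) + (f.roots.map fun b => w (X - C b)).sum := by
  conv_lhs => rw [(IsAlgClosed.splits f).eq_prod_roots]
  rw [AddValuation.map_mul, map_prod_eq_sum, Multiset.map_map]
  rfl

theorem val_C_eval_eq_sum_roots [IsAlgClosed L] (f : L[X]) (a : L) :
    w (C (f.eval a)) =
      w (C f.leadingCoeff) + (f.roots.map fun b => w (C a - C b)).sum := by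
  have : C (f.eval a) = C f.leadingCoeff * (f.roots.map fun b => C a - C b).prod := by
    conv_lhs => rw [(IsAlgClosed.splits f).eq_prod_roots]
    rw [eval_mul, eval_C, eval_multiset_prod, C_mul, Multiset.map_map, map_multiset_prod,
      Multiset.map_map]
    simp
  rw [this, AddValuation.map_mul, map_prod_eq_sum, Multiset.map_map]
  rfl

variable {w}

/-- If `a` is at least as close to `x` as all the roots of `f`, then `w(f) ≤ w(f(a))`. -/
theorem val_le_val_C_eval [IsAlgClosed L] {f : L[X]} {a : L}
    (h : delta w f ≤ ((w (X - C a) : WithTop Γ) : WithBot (WithTop Γ))) :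
    w f ≤ w (C (f.eval a)) := by
  rw [val_eq_sum_roots w f, val_C_eval_eq_sum_roots]
  refine add_le_add_right (Multiset.sum_map_le_sum_map _ _ fun b hb => ?_) _
  have hab : w (X - C b) ≤ w (X - C a) := WithBot.coe_le_coe.1
    ((Multiset.le_sup (Multiset.mem_map_of_mem _ hb)).trans h)
  have : (C a - C b : L[X]) = (X - C b) - (X - C a) := by ring
  rw [this]
  exact AddValuation.map_le_sub _ le_rfl hab

/-- If `a` is closer to `x` than all the roots of `f`, then `w(f) = w(f(a))`. -/
theorem val_C_eval_eq [IsAlgClosed L] {f : L[X]} {a : L}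
    (h : delta w f < ((w (X - C a) : WithTop Γ) : WithBot (WithTop Γ))) :
    w (C (f.eval a)) = w f := by
  rw [val_eq_sum_roots w f, val_C_eval_eq_sum_roots]
  congr 2
  refine Multiset.map_congr rfl fun b hb => ?_
  have hab : w (X - C b) < w (X - C a) := WithBot.coe_lt_coe.1
    ((Multiset.le_sup (Multiset.mem_map_of_mem _ hb)).trans_lt h)
  have : (C a - C b : L[X]) = (X - C b) - (X - C a) := by ring
  rw [this]
  exact AddValuation.map_sub_eq_of_lt_left _ hab

/-- The maximum in the definition of `δ(f)` is attained. -/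
theorem exists_root_delta_eq [IsAlgClosed L] {f : L[X]} (hf : 0 < f.natDegree) :
    ∃ a ∈ f.roots, delta w f = ((w (X - C a) : WithTop Γ) : WithBot (WithTop Γ)) := by
  classical
  have h0 : f.roots ≠ 0 := by
    obtain ⟨a, ha⟩ := IsAlgClosed.exists_root f (natDegree_pos_iff_degree_pos.1 hf).ne'
    intro h
    have : a ∈ f.roots := (mem_roots (by rintro rfl; simp at hf)).2 ha
    simp [h] at this
  obtain ⟨a, ha, hmax⟩ := f.roots.toFinset.exists_max_image (fun a => w (X - C a))
    (Multiset.toFinset_nonempty.2 h0)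
  rw [Multiset.mem_toFinset] at ha
  refine ⟨a, ha, le_antisymm (Multiset.sup_le.2 fun b hb => ?_)
    (Multiset.le_sup (Multiset.mem_map_of_mem _ ha))⟩
  obtain ⟨c, hc, rfl⟩ := Multiset.mem_map.1 hb
  exact WithBot.coe_le_coe.2 (hmax c (Multiset.mem_toFinset.2 hc))

/-- `Q` is a key polynomial if every division of `Q` by a non-constant polynomial of smaller degree
has a remainder `r` with `μ(r) < μ(Q)`. -/
theorem isKeyPolynomial_of_forall_mod {μ : AddValuation K[X] (WithTop Γ)} {Q : K[X]}
    (hQ : Q.Monic) (hpos : 0 < Q.natDegree)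
    (h : ∀ f : K[X], 0 < f.natDegree → f.natDegree < Q.natDegree → μ (Q % f) < μ Q) :
    IsKeyPolynomial μ Q := by
  refine ⟨hQ, fun w hw => ?_⟩
  set φ := algebraMap K (AlgebraicClosure K)
  have hQφ : 0 < (Q.map φ).natDegree := by rwa [natDegree_map]
  by_contra! H
  obtain ⟨n, hn⟩ : ∃ n, ∃ f : K[X], f ≠ 0 ∧ delta w (Q.map φ) ≤ delta w (f.map φ) ∧
      f.degree < Q.degree ∧ f.natDegree = n := by
    obtain ⟨f, h1, h2, h3⟩ := H
    exact ⟨_, f, h1, h2, h3, rfl⟩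
  clear H
  induction n using Nat.strong_induction_on with
  | _ n ih =>
    obtain ⟨f, hf0, hδ, hdeg, rfl⟩ := hn
    have hfpos : 0 < f.natDegree := by
      rw [Nat.pos_iff_ne_zero]
      intro hfn
      obtain ⟨b, -, hb⟩ := exists_root_delta_eq (w := w) hQφ
      rw [eq_C_of_natDegree_eq_zero hfn, hb] at hδ
      simp [delta] at hδ
    obtain ⟨a, ha, hδa⟩ := exists_root_delta_eq (w := w) (f := f.map φ) (by rwa [natDegree_map])
    have hroot : (f.map φ).eval a = 0 := isRoot_of_mem_roots ha
    rw [hδa] at hδ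
    have heval : (Q.map φ).eval a = ((Q % f).map φ).eval a := by
      conv_lhs => rw [← EuclideanDomain.div_add_mod Q f]
      rw [Polynomial.map_add, Polynomial.map_mul, eval_add, eval_mul, hroot, zero_mul, zero_add]
    have hlt := h f hfpos (natDegree_lt_natDegree hf0 hdeg)
    have hle := val_le_val_C_eval hδ
    rw [heval, hw] at hle
    have hr0 : Q % f ≠ 0 := by
      intro h0
      rw [h0, AddValuation.map_zero] at hlt
      exact not_top_lt hlt
    by_cases hδr : delta w (Q.map φ) ≤ delta w ((Q % f).map φ)
    · exact ih _ (natDegree_mod_lt Q hfpos.ne') ⟨Q % f, hr0, hδr,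
        (degree_mod_lt Q hf0).trans hdeg, rfl⟩
    · rw [val_C_eval_eq ((not_le.1 hδr).trans_le hδ), hw] at hle
      exact hlt.not_ge hle

end Delta

section Main

variable {ν₀ : AddValuation K (WithTop Γ)} {v : Set (ValPoset ν₀)} {Q : K[X]}

/-- A nontrivial division of an unstable polynomial of least degree has a remainder of small stable
value. -/
theorem stableValue_mod_lt (hchain : IsChain (· ≤ ·) v) {ν : PolyVal ν₀}
    (hν : (ν : ValPoset ν₀) ∈ v) (hQv : ¬ IsStable v Q)
    (hmin : ∀ f : K[X], f.natDegree < Q.natDegree → IsStable v f) {γ : WithTop Γ}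
    (hγ : ∀ ν : PolyVal ν₀, (ν : ValPoset ν₀) ∈ v → ν.val Q < γ)
    {f : K[X]} (hf : 0 < f.natDegree) (hfQ : f.natDegree < Q.natDegree) :
    stableValue v (Q % f) < γ := by
  by_contra! hle
  have hd : (Q / f).natDegree < Q.natDegree :=
    natDegree_lt_natDegree
      (fun h0 => by
        rw [Polynomial.div_eq_zero_iff (by rintro rfl; simp at hf)] at h0
        exact hfQ.not_ge (natDegree_le_natDegree h0.le))
      (degree_div_lt (by rintro rfl; simp at hfQ) (natDegree_pos_iff_degree_pos.1 hf))
  obtain ⟨ν', hν', -, h⟩ := exists_isStableFrom_forall hchain hν Finset.univ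
    ![f, Q / f, Q % f] (by
      simp [Fin.forall_fin_succ, hmin f hfQ, hmin _ hd,
        hmin _ ((natDegree_mod_lt Q hf.ne').trans hfQ)])
  simp [Fin.forall_fin_succ] at h
  obtain ⟨h1, h2, h3⟩ := h
  rw [stableValue_eq hchain h3] at hle
  have hfq : ∀ ν'' : PolyVal ν₀, (ν'' : ValPoset ν₀) ∈ v → ν' ≤ ν'' →
      ν''.val Q = ν''.val (f * (Q / f)) := by
    intro ν'' hν'' hle'
    have : f * (Q / f) = Q - Q % f := by linear_combination EuclideanDomain.div_add_mod Q f
    rw [this, AddValuation.map_sub_eq_of_lt_left]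
    exact ((hγ ν'' hν'').trans_le hle).trans_le (h3.2 ν'' hν'' hle').ge
  refine hQv ⟨ν', hν', fun ν'' hν'' hle' => ?_⟩
  rw [hfq ν'' hν'' hle', hfq ν' hν' le_rfl, (h1.mul h2).2 ν'' hν'' hle']

end Main

end KeyPoly

end

theorem mainTheorem5 {K : Type*} [Field K]
    {Γ : Type*} [AddCommGroup Γ] [LinearOrder Γ] [IsOrderedAddMonoid Γ]
    (hΓ : ∀ n : ℕ, n ≠ 0 → ∀ x : Γ, ∃ y : Γ, n • y = x)
    (ν₀ : AddValuation K (WithTop Γ))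
    (v : Set (KeyPoly.ValPoset ν₀)) (hne : v.Nonempty) (hchain : IsChain (· ≤ ·) v)
    (hmax : ∀ ν ∈ v, ∃ ν' ∈ v, ν < ν')
    (Q : Polynomial K) (hQ : Q.Monic) (hQv : ¬ KeyPoly.IsStable v Q)
    (hmin : ∀ f : Polynomial K, ¬ KeyPoly.IsStable v f → Q.degree ≤ f.degree)
    (γ : WithTop Γ)
    (hγ : ∀ ν : KeyPoly.PolyVal ν₀, (ν : KeyPoly.ValPoset ν₀) ∈ v → ν.val Q < γ) :
    ∃ μ : KeyPoly.PolyVal ν₀,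
      (∀ f : Polynomial K, μ.val f = KeyPoly.limitMap v Q γ f) ∧
      (∀ ν ∈ v, ν < (μ : KeyPoly.ValPoset ν₀)) ∧
      (∀ f : Polynomial K, μ.val f = KeyPoly.truncation μ.val Q f) ∧
      KeyPoly.IsKeyPolynomial μ.val Q := by
  obtain ⟨ν, hν⟩ : ∃ ν : KeyPoly.PolyVal ν₀, (ν : KeyPoly.ValPoset ν₀) ∈ v := by
    obtain ⟨ν₁, h₁⟩ := hne
    obtain ⟨ν₂, h₂, hlt⟩ := hmax ν₁ h₁
    obtain ⟨ν, rfl⟩ := WithBot.ne_bot_iff_exists.1 (bot_le.trans_lt hlt).ne'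
    exact ⟨ν, h₂⟩
  have hstable : ∀ f : Polynomial K, f.natDegree < Q.natDegree → KeyPoly.IsStable v f :=
    fun f hf => by
      by_contra hfv
      exact (hmin f hfv).not_gt (Polynomial.degree_lt_degree hf)
  have h := KeyPoly.isResidual_stableValue hchain hν hQ hQv hstable hγ
  refine ⟨⟨h.valuation, fun a => ?_⟩, fun f => rfl, fun ν' hν' => ?_, h.valuation_eq_truncation, ?_⟩
  · rw [h.valuation_of_natDegree_lt (by simpa using h.natDegree_pos),
      KeyPoly.stableValue_eq hchain (KeyPoly.isStableFrom_C hν a), ν.val_C]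
  · induction ν' using WithBot.recBotCoe with
    | bot => exact WithBot.bot_lt_coe _
    | coe ν' =>
      refine WithBot.coe_lt_coe.2 (lt_of_le_not_ge
        (KeyPoly.val_le_expansionMin_stableValue hchain hQv hstable hγ h hν') fun hge => ?_)
      exact ((hγ ν' hν').trans_le h.valuation_self.ge).not_ge (hge Q)
  · refine KeyPoly.isKeyPolynomial_of_forall_mod hQ h.natDegree_pos fun f hf hfQ => ?_
    change h.valuation _ < h.valuation _
    rw [h.valuation_self, h.valuation_of_natDegree_lt
      ((Polynomial.natDegree_mod_lt Q hf.ne').trans hfQ)]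
    exact KeyPoly.stableValue_mod_lt hchain hν hQv hstable hγ hf hfQ
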